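/- For every positive integer $k$ there is an integer $n_0=n_0(k)$ such that the following holds for all $n\ge n_0$. Let $t\ge 2$ and let $k_1,\dots,k_t$ be positive integers with $\max_{i} k_i=k$, with $k_1\ge k_i$ and $k_2\ge k_i$ for all $3\le i\le t$, and with $$\sum_{i=1}^t k_i\le n\left(1-\left(\frac{8k\ln n}{n}\right)^{1/k}\right).$$ Write $[n]=\{1,\dots,n\}$, let $\binom{[n]}{k_i}$ be the set of all $k_i$-element subsets of $[n]$, and put $$B=\binom{n-1}{k_1-1}\binom{n-1}{k_2-1}\prod_{i=3}^t\binom{n}{k_i},$$ where the last product is $1$ if $t=2$. If $\mathcal F_i\subseteq\binom{[n]}{k_i}$ for $1\le i\le t$ and $\prod_{i=1}^t|\mathcal F_i|>B$, then $\mathcal F_1,\dots,\mathcal F_t$ admit a rainbow matching, that is, there are pairwise disjoint sets $e_1\in\mathcal F_1,\dots,e_t\in\mathcal F_t$. The bound is tight: the maximum of $\prod_{i=1}^t|\mathcal R_i|$ over all $\mathcal R_i\subseteq\binom{[n]}{k_i}$ ($1\le i\le t$) that admit no rainbow matching is exactly $B$. -/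

import Mathlib

/-- An indexed family of hypergraphs `F i` (finite sets of edges on a common vertex type) admits a
rainbow matching: one can choose an edge `e i` of each `F i` so that the chosen edges are
pairwise disjoint. -/
def AdmitsRainbowMatching {ι α : Type*} (F : ι → Finset (Finset α)) : Prop :=
  ∃ e : ι → Finset α, (∀ i, e i ∈ F i) ∧ ∀ i j, i ≠ j → Disjoint (e i) (e j)

/-- `F i` is a set of `k i`-element subsets of an `n`-element ground set, for every `i`. -/
def IsUniformFamily (n : ℕ) {t : ℕ} (k : Fin t → ℕ) (F : Fin t → Finset (Finset (Fin n))) : Prop :=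
  ∀ i, F i ⊆ Finset.powersetCard (k i) (Finset.univ : Finset (Fin n))

/-- The number `C(n-1, k₁-1) * C(n-1, k₂-1) * ∏_{i ≥ 3} C(n, k_i)`. The indices `1, 2, …, t` are
the elements `0, 1, …, t-1` of `Fin t`; for `t = 2` the last product is empty, hence `1`. -/
def productBound (n : ℕ) {t : ℕ} (ht : 2 ≤ t) (k : Fin t → ℕ) : ℕ :=
  (n - 1).choose (k ⟨0, by omega⟩ - 1) * (n - 1).choose (k ⟨1, by omega⟩ - 1) *
    ∏ i ∈ Finset.univ.filter (fun i : Fin t => 2 ≤ (i : ℕ)), n.choose (k i)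

/-! Let `p i` be the density of `F i` among all `k i`-sets. The hypothesis says exactly that `∏ p i`
exceeds `k₁ k₂ / n ^ 2`. List the families by increasing density. Densities are at most 1, so the
two sparsest already have density product above this threshold, and a product version of
Erdős–Ko–Rado (`exists_disjoint_of_lt_card_mul_card`) gives them disjoint edges.

The rest is greedy. With indices from 0, `p i ^ (i + 1)` dominates the product of the first `i + 1`
densities, hence exceeds `1 / n ^ 2`: this bounds `p i` from below, and logarithms give `(i + 1) (1
- p i) < 2 log n`. So `F i` is too dense for all its edges to meet the set `S` of vertices used so
far. The bound on `∑ k i` is needed only when `i` is of order `n`. -/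

open Finset Filter

/-! ### Cross-intersecting families. -/

/-- The union bound for a family of `k`-sets each of which contains one of the `r`-sets `T i`. -/
theorem card_le_of_forall_exists_subset {α β : Type*} [Fintype α] [DecidableEq α] {k r : ℕ}
    {A : Finset (Finset α)} (hA : A ⊆ powersetCard k univ) (I : Finset β) (T : β → Finset α)
    (hT : ∀ i ∈ I, #(T i) = r) (hr : r ≤ k) (h : ∀ e ∈ A, ∃ i ∈ I, T i ⊆ e) :
    #A ≤ #I * (Fintype.card α - r).choose (k - r) := by
  classical
  have hsub : A ⊆ I.biUnion fun i ↦ {e ∈ powersetCard k univ | T i ⊆ e} := by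
    intro e he
    obtain ⟨i, hi, hie⟩ := h e he
    exact mem_biUnion.2 ⟨i, hi, mem_filter.2 ⟨hA he, hie⟩⟩
  refine (card_le_card hsub).trans (card_biUnion_le_card_mul _ _ _ fun i hi ↦ ?_)
  rw [card_filter_powersetCard_subset _ _ _ (subset_univ _) ((hT i hi).trans_le hr), hT i hi,
    card_univ]

theorem card_star {α : Type*} [Fintype α] [DecidableEq α] {k : ℕ} (hk : 1 ≤ k) (v : α) :
    #{e ∈ powersetCard k (univ : Finset α) | v ∈ e} = (Fintype.card α - 1).choose (k - 1) := by
  have := card_filter_powersetCard_subset {v} (univ : Finset α) k (subset_univ _)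
    (by simpa using hk)
  simpa using this

theorem mul_choose_pred {n k : ℕ} (hn : 1 ≤ n) (hk : 1 ≤ k) :
    n * (n - 1).choose (k - 1) = k * n.choose k := by
  obtain ⟨n, rfl⟩ := Nat.exists_eq_add_of_le' hn
  obtain ⟨k, rfl⟩ := Nat.exists_eq_add_of_le' hk
  simpa [mul_comm (k + 1)] using Nat.add_one_mul_choose_eq n k

/-- If every set of `B` meets every set of `A` and `A` has no common element, then two elements of
each set of `B` can be located among few candidates. -/
theorem card_mul_card_le_of_not_star {α : Type*} [Fintype α] [DecidableEq α] {a b : ℕ}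
    (ha : 1 ≤ a) (hb : 1 ≤ b) (hn : a ^ 2 * b ^ 2 < Fintype.card α)
    {A B : Finset (Finset α)} (hA : A ⊆ powersetCard a univ) (hB : B ⊆ powersetCard b univ)
    (hAB : ∀ e ∈ A, ∀ f ∈ B, ¬ Disjoint e f) (hstar : ¬ ∃ v, ∀ e ∈ A, v ∈ e) :
    #A * #B ≤ (Fintype.card α - 1).choose (a - 1) * (Fintype.card α - 1).choose (b - 1) := by
  rcases B.eq_empty_or_nonempty with rfl | ⟨f₀, hf₀⟩
  · simp
  rcases A.eq_empty_or_nonempty with rfl | ⟨e₀, he₀⟩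
  · simp
  push Not at hstar
  choose g hgA hg using hstar
  have hcA : ∀ e ∈ A, #e = a := fun e he ↦ (mem_powersetCard.1 (hA he)).2
  have hcB : ∀ e ∈ B, #e = b := fun e he ↦ (mem_powersetCard.1 (hB he)).2
  have h1 : #A ≤ b * (Fintype.card α - 1).choose (a - 1) := by
    have := card_le_of_forall_exists_subset (r := 1) hA f₀ (fun v ↦ {v}) (by simp) ha
      (fun e he ↦ by
        obtain ⟨v, hv, hv'⟩ := not_disjoint_iff.1 (hAB e he f₀ hf₀)
        exact ⟨v, hv', by simpa using hv⟩)
    rwa [hcB f₀ hf₀] at this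
  -- `g v` is a member of `A` missing `v`, so `f` meets `e₀` in some `v` and `g v` in a second
  -- point: at most `a * a` pairs.
  have hpair : ∀ f ∈ B, ∃ p ∈ e₀.sigma g, ({p.1, p.2} : Finset α) ⊆ f := by
    intro f hf
    obtain ⟨v, hv, hv'⟩ := not_disjoint_iff.1 (hAB e₀ he₀ f hf)
    obtain ⟨w, hw, hw'⟩ := not_disjoint_iff.1 (hAB (g v) (hgA v) f hf)
    exact ⟨⟨v, w⟩, mem_sigma.2 ⟨hv, hw⟩, by simp [insert_subset_iff, hv', hw']⟩
  have hne : ∀ p ∈ e₀.sigma g, #({p.1, p.2} : Finset α) = 2 := by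
    rintro ⟨v, w⟩ hp
    refine card_pair ?_
    intro hvw
    obtain rfl : v = w := hvw
    exact hg v (mem_sigma.1 hp).2
  have hb2 : 2 ≤ b := by
    obtain ⟨p, hp, hpf⟩ := hpair f₀ hf₀
    calc 2 = #({p.1, p.2} : Finset α) := (hne p hp).symm
      _ ≤ #f₀ := card_le_card hpf
      _ = b := hcB f₀ hf₀
  have h2 : #B ≤ a * a * (Fintype.card α - 2).choose (b - 2) := by
    have := card_le_of_forall_exists_subset hB _ _ hne hb2 hpair
    rwa [card_sigma, sum_congr rfl fun v _ ↦ hcA _ (hgA v), sum_const, hcA e₀ he₀,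
      smul_eq_mul] at this
  have hpos : 0 < a ^ 2 * b ^ 2 := by positivity
  have h3 := mul_choose_pred (n := Fintype.card α - 1) (k := b - 1) (by omega) (by omega)
  rw [Nat.sub_sub, Nat.sub_sub] at h3
  have hn' : a ^ 2 * b ^ 2 ≤ Fintype.card α - 1 := by omega
  set N := Fintype.card α
  -- Fixing a second point gains a factor `(b - 1) / (N - 1)`, which absorbs the loss `a ^ 2 * b`
  -- from the two union bounds.
  have h4 : a ^ 2 * b ^ 2 * (a * a * b * (N - 2).choose (b - 2)) ≤
      a ^ 2 * b ^ 2 * (N - 1).choose (b - 1) := by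
    calc a ^ 2 * b ^ 2 * (a * a * b * (N - 2).choose (b - 2))
        ≤ (N - 1) * (a * a * b * (N - 2).choose (b - 2)) := Nat.mul_le_mul_right _ hn'
      _ = a * a * b * ((N - 1) * (N - 2).choose (b - 2)) := by ring
      _ = a * a * b * ((b - 1) * (N - 1).choose (b - 1)) := by rw [h3]
      _ ≤ a * a * b * (b * (N - 1).choose (b - 1)) := by gcongr; omega
      _ = a ^ 2 * b ^ 2 * (N - 1).choose (b - 1) := by ring
  have h5 := Nat.le_of_mul_le_mul_left h4 hpos
  calc #A * #B ≤ (b * (N - 1).choose (a - 1)) * (a * a * (N - 2).choose (b - 2)) :=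
        Nat.mul_le_mul h1 h2
    _ = (N - 1).choose (a - 1) * (a * a * b * (N - 2).choose (b - 2)) := by ring
    _ ≤ _ := Nat.mul_le_mul_left _ h5

/-- The product bound for cross-intersecting families on a large ground set. -/
theorem exists_disjoint_of_lt_card_mul_card {α : Type*} [Fintype α] [DecidableEq α] {a b : ℕ}
    (ha : 1 ≤ a) (hb : 1 ≤ b) (hn : a ^ 2 * b ^ 2 < Fintype.card α)
    {A B : Finset (Finset α)} (hA : A ⊆ powersetCard a univ) (hB : B ⊆ powersetCard b univ)
    (h : (Fintype.card α - 1).choose (a - 1) * (Fintype.card α - 1).choose (b - 1) < #A * #B) :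
    ∃ e ∈ A, ∃ f ∈ B, Disjoint e f := by
  by_contra! hAB
  have hstar : ∀ {k : ℕ}, 1 ≤ k → ∀ {C : Finset (Finset α)}, C ⊆ powersetCard k univ →
      (∃ v, ∀ e ∈ C, v ∈ e) → #C ≤ (Fintype.card α - 1).choose (k - 1) := by
    rintro k hk C hC ⟨v, hv⟩
    rw [← card_star hk v]
    exact card_le_card fun e he ↦ mem_filter.2 ⟨hC he, hv e he⟩
  by_cases h1 : ∃ v, ∀ e ∈ A, v ∈ e
  · by_cases h2 : ∃ v, ∀ e ∈ B, v ∈ e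
    · exact h.not_ge (Nat.mul_le_mul (hstar ha hA h1) (hstar hb hB h2))
    · refine h.not_ge ?_
      rw [mul_comm #A, mul_comm (Nat.choose _ _)]
      exact card_mul_card_le_of_not_star hb ha (by rwa [mul_comm]) hB hA
        (fun e he f hf hd ↦ hAB f hf e he hd.symm) h2
  · exact h.not_ge (card_mul_card_le_of_not_star ha hb hn hA hB hAB h1)

/-! ### Edges avoiding a given vertex set. -/

/-- Pigeonhole: `A` and the family of `k`-sets avoiding `S` are together too large to be disjoint.
-/
theorem exists_mem_disjoint {α : Type*} [Fintype α] [DecidableEq α] {k : ℕ}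
    {A : Finset (Finset α)} (hA : A ⊆ powersetCard k univ) (S : Finset α)
    (h : (Fintype.card α).choose k < #A + (Fintype.card α - #S).choose k) :
    ∃ e ∈ A, Disjoint e S := by
  by_contra! hd
  have hdis : Disjoint A (powersetCard k Sᶜ) := by
    refine disjoint_left.2 fun e he he' ↦ hd e he ?_
    exact disjoint_left.2 fun v hv ↦ mem_compl.1 ((mem_powersetCard.1 he').1 hv)
  have hle := card_le_card (union_subset hA (powersetCard_mono (subset_univ Sᶜ)))
  rw [card_union_of_disjoint hdis, card_powersetCard, card_powersetCard, card_compl,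
    card_univ] at hle
  omega

theorem pow_mul_choose_le_choose {n m k : ℕ} {r : ℝ} (hr : 0 ≤ r) (hm : k ≤ m) (hn : k ≤ n)
    (h : ∀ j < k, r * (n - j : ℝ) ≤ m - j) : r ^ k * n.choose k ≤ m.choose k := by
  have key : r ^ k * n.descFactorial k ≤ m.descFactorial k := by
    induction k with
    | zero => simp
    | succ k ih =>
      rw [Nat.descFactorial_succ, Nat.descFactorial_succ, Nat.cast_mul, Nat.cast_mul,
        Nat.cast_sub (by omega), Nat.cast_sub (by omega)]
      have h1 := ih (by omega) (by omega) fun j hj ↦ h j (by omega)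
      have h2 := h k (by omega)
      have hnk : (0 : ℝ) ≤ n - k := sub_nonneg.2 (by exact_mod_cast (by omega : k ≤ n))
      calc r ^ (k + 1) * ((n - k : ℝ) * n.descFactorial k)
          = (r * (n - k)) * (r ^ k * n.descFactorial k) := by ring
        _ ≤ (m - k) * m.descFactorial k := by gcongr; exact (mul_nonneg hr hnk).trans h2
  rw [Nat.descFactorial_eq_factorial_mul_choose, Nat.descFactorial_eq_factorial_mul_choose,
    Nat.cast_mul, Nat.cast_mul, mul_left_comm] at key
  exact le_of_mul_le_mul_left key (by positivity)

/-- Pascal's rule, deleting the `s` points one at a time. -/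
theorem choose_le_choose_sub_add {n k : ℕ} (hk : 1 ≤ k) {s : ℕ} (hs : s ≤ n) :
    n.choose k ≤ (n - s).choose k + s * (n - 1).choose (k - 1) := by
  induction s with
  | zero => simp
  | succ s ih =>
    have h1 := ih (by omega)
    have h2 : (n - s).choose k = (n - (s + 1)).choose (k - 1) + (n - (s + 1)).choose k := by
      rw [show n - s = n - (s + 1) + 1 by omega, Nat.choose_succ_left _ _ hk]
    have h3 : (n - (s + 1)).choose (k - 1) ≤ (n - 1).choose (k - 1) :=
      Nat.choose_le_choose _ (by omega)
    rw [add_mul]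
    omega

/-! ### The greedy matching. -/

/-- Greedy completion of a rainbow matching of the first two families. -/
theorem admitsRainbowMatching_of_greedy {α : Type*} [DecidableEq α] {t : ℕ}
    (ht : 2 ≤ t) {k : Fin t → ℕ} {F : Fin t → Finset (Finset α)}
    (hF : ∀ i, ∀ e ∈ F i, #e = k i)
    (h2 : ∃ e ∈ F ⟨0, by omega⟩, ∃ f ∈ F ⟨1, by omega⟩, Disjoint e f)
    (h : ∀ i : Fin t, 2 ≤ (i : ℕ) → ∀ S : Finset α, #S ≤ ∑ j ∈ Iio i, k j →
      ∃ e ∈ F i, Disjoint e S) : AdmitsRainbowMatching F := by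
  suffices H : ∀ r, 2 ≤ r → r ≤ t → ∃ e : Fin t → Finset α, (∀ i : Fin t, (i : ℕ) < r → e i ∈ F i) ∧
      ∀ i j : Fin t, (i : ℕ) < r → (j : ℕ) < r → i ≠ j → Disjoint (e i) (e j) by
    obtain ⟨e, he, hd⟩ := H t ht le_rfl
    exact ⟨e, fun i ↦ he i i.2, fun i j ↦ hd i j i.2 j.2⟩
  intro r hr
  induction r, hr using Nat.le_induction with
  | base =>
    intro _
    obtain ⟨e, he, f, hf, hd⟩ := h2
    refine ⟨fun i ↦ if (i : ℕ) = 0 then e else f, ?_, ?_⟩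
    · rintro ⟨i, hi⟩ hi2
      obtain rfl | rfl : i = 0 ∨ i = 1 := by simp at hi2; omega
      · simpa using he
      · simpa using hf
    · rintro ⟨i, hi⟩ ⟨j, hj⟩ hi2 hj2 hij
      simp only [ne_eq, Fin.mk.injEq] at hi2 hj2 hij
      obtain ⟨rfl, rfl⟩ | ⟨rfl, rfl⟩ : (i = 0 ∧ j = 1) ∨ (i = 1 ∧ j = 0) := by omega
      · simpa using hd
      · simpa using hd.symm
  | succ r hr ih =>
    intro hrt
    obtain ⟨e, he, hd⟩ := ih (by omega)
    let i₀ : Fin t := ⟨r, by omega⟩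
    obtain ⟨f, hf, hfd⟩ := h i₀ hr ((Iio i₀).biUnion e) <| card_biUnion_le.trans <|
      sum_le_sum fun j hj ↦ (hF j _ (he j (show j < i₀ from mem_Iio.1 hj))).le
    have hlt : ∀ {i : Fin t}, (i : ℕ) < r + 1 → i ≠ i₀ → (i : ℕ) < r := by
      intro i hi hne
      have : (i : ℕ) ≠ r := fun h ↦ hne (Fin.ext h)
      omega
    have hfd' : ∀ i : Fin t, (i : ℕ) < r → Disjoint f (e i) := fun i hi ↦
      hfd.mono_right (subset_biUnion_of_mem e (mem_Iio.2 hi))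
    refine ⟨Function.update e i₀ f, fun i hi ↦ ?_, fun i j hi hj hij ↦ ?_⟩
    · by_cases hii : i = i₀
      · subst hii; simpa using hf
      · simpa [hii] using he i (hlt hi hii)
    · by_cases hii : i = i₀
      · have hjj : j ≠ i₀ := fun h ↦ hij (hii.trans h.symm)
        rw [hii, Function.update_self, Function.update_of_ne hjj]
        exact hfd' j (hlt hj hjj)
      · rw [Function.update_of_ne hii]
        by_cases hjj : j = i₀
        · rw [hjj, Function.update_self]
          exact (hfd' i (hlt hi hii)).symm
        · rw [Function.update_of_ne hjj]
          exact hd i j (hlt hi hii) (hlt hj hjj) hij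

/-- The greedy step: a dense family has a member avoiding a small vertex set. -/
theorem exists_mem_disjoint_of_density {n k : ℕ} {A : Finset (Finset (Fin n))}
    (hA : A ⊆ powersetCard k univ) {S : Finset (Fin n)} {p r : ℝ} (hr : 0 ≤ r)
    (hp : p * n.choose k = #A) (hm : #S + k ≤ n) (hpr : 1 - p < r ^ k)
    (h : ∀ j < k, r * (n - j : ℝ) ≤ n - #S - j) : ∃ e ∈ A, Disjoint e S := by
  apply exists_mem_disjoint hA
  rw [Fintype.card_fin]
  have hC : (0 : ℝ) < n.choose k := by exact_mod_cast Nat.choose_pos (by omega)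
  have h1 := pow_mul_choose_le_choose (n := n) (m := n - #S) (k := k) hr (by omega) (by omega)
    (by simpa [Nat.cast_sub (show #S ≤ n by omega)] using h)
  have h2 : (n.choose k : ℝ) < #A + ((n - #S).choose k : ℕ) := by
    rw [← hp]
    nlinarith [mul_lt_mul_of_pos_right hpr hC]
  exact_mod_cast h2

theorem exists_mem_disjoint_of_union_bound {n k : ℕ} {A : Finset (Finset (Fin n))}
    (hA : A ⊆ powersetCard k univ) {S : Finset (Fin n)} {p : ℝ} (hk : 1 ≤ k)
    (hp : p * n.choose k = #A) (hm : #S + k ≤ n) (hpr : (#S * k : ℝ) / n < p) :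
    ∃ e ∈ A, Disjoint e S := by
  apply exists_mem_disjoint hA
  rw [Fintype.card_fin]
  have hC : (0 : ℝ) < n.choose k := by exact_mod_cast Nat.choose_pos (by omega)
  have hn : (0 : ℝ) < n := by exact_mod_cast (by omega : 0 < n)
  have h1 : (n.choose k : ℝ) ≤ ((n - #S).choose k : ℕ) + #S * ((n - 1).choose (k - 1) : ℕ) := by
    exact_mod_cast choose_le_choose_sub_add hk (by omega)
  have h2 : (n : ℝ) * ((n - 1).choose (k - 1) : ℕ) = k * n.choose k := by
    exact_mod_cast mul_choose_pred (by omega) hk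
  have h3 : (#S : ℝ) * ((n - 1).choose (k - 1) : ℕ) = #S * k / n * n.choose k := by
    field_simp
    linear_combination (#S : ℝ) * h2
  have h4 : (n.choose k : ℝ) < #A + ((n - #S).choose k : ℕ) := by
    rw [← hp]
    have := mul_lt_mul_of_pos_right hpr hC
    linarith
  exact_mod_cast h4

/-- Take logarithms and use `log p ≤ p - 1`. -/
theorem mul_one_sub_lt_of_lt_pow {p x : ℝ} {m : ℕ} (hp : 0 < p) (hx : 0 < x)
    (h : 1 / x ^ 2 < p ^ m) : m * (1 - p) < 2 * Real.log x := by
  have h1 := Real.log_lt_log (by positivity) h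
  rw [Real.log_pow, one_div, Real.log_inv, Real.log_pow] at h1
  have h2 := mul_le_mul_of_nonneg_left (Real.log_le_sub_one_of_pos hp) (Nat.cast_nonneg (α := ℝ) m)
  push_cast at h1
  linarith

/-- A rainbow matching exists when the families are listed by increasing density. -/
theorem admitsRainbowMatching_of_monotone {n K t : ℕ} (ht : 2 ≤ t) (hK : 1 ≤ K)
    (hn : K ^ 4 < n) (hn4 : 4 * K ≤ n)
    (hlog : ((K : ℝ) ^ 2 * 2 ^ (K + 1) * Real.log n) ^ 3 ≤ n)
    {k : Fin t → ℕ} (hk : ∀ i, 1 ≤ k i) (hkK : ∀ i, k i ≤ K)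
    (hsum : ((∑ i, k i : ℕ) : ℝ) ≤
      (n : ℝ) * (1 - (8 * (K : ℝ) * Real.log n / n) ^ ((1 : ℝ) / (K : ℝ))))
    {F : Fin t → Finset (Finset (Fin n))} (hF : IsUniformFamily n k F)
    {p : Fin t → ℝ} (hp : ∀ i, p i * n.choose (k i) = #(F i)) (hmono : Monotone p)
    (hprod : (k ⟨0, by omega⟩ * k ⟨1, by omega⟩ : ℝ) / n ^ 2 < ∏ i, p i) :
    AdmitsRainbowMatching F := by
  have hn0 : 0 < n := by omega
  have hnR : (0 : ℝ) < n := by exact_mod_cast hn0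
  have hKR : (1 : ℝ) ≤ K := by exact_mod_cast hK
  have hL : 0 ≤ Real.log n := Real.log_natCast_nonneg n
  have hC : ∀ i, (0 : ℝ) < n.choose (k i) := fun i ↦ by
    exact_mod_cast Nat.choose_pos (by have := hkK i; omega)
  have hp0 : ∀ i, 0 ≤ p i := fun i ↦
    nonneg_of_mul_nonneg_left ((hp i).symm ▸ Nat.cast_nonneg _) (hC i)
  have hp1 : ∀ i, p i ≤ 1 := fun i ↦ by
    refine le_of_mul_le_mul_right ?_ (hC i)
    rw [hp i, one_mul]
    simpa using card_le_card (hF i)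
  have hsub : ∀ s : Finset (Fin t), ∏ i, p i ≤ ∏ i ∈ s, p i := fun s ↦
    prod_le_prod_of_subset_of_le_one (subset_univ s) (fun i _ ↦ hp0 i) fun i _ _ ↦ hp1 i
  refine admitsRainbowMatching_of_greedy ht (k := k)
    (fun i e he ↦ (mem_powersetCard.1 (hF i he)).2) ?_ ?_
  · set a : Fin t := ⟨0, by omega⟩
    set b : Fin t := ⟨1, by omega⟩
    have hab : a ≠ b := by simp [a, b]
    have h1 : (k a * k b : ℝ) / n ^ 2 < p a * p b :=
      hprod.trans_le ((hsub {a, b}).trans_eq (prod_pair hab))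
    refine exists_disjoint_of_lt_card_mul_card (hk a) (hk b) ?_ (hF a) (hF b) ?_
    · rw [Fintype.card_fin]
      refine lt_of_le_of_lt ?_ hn
      calc k a ^ 2 * k b ^ 2 ≤ K ^ 2 * K ^ 2 := by gcongr <;> apply hkK
        _ = K ^ 4 := by ring
    · rw [Fintype.card_fin]
      have e1 : (n : ℝ) * ((n - 1).choose (k a - 1) : ℕ) = k a * n.choose (k a) := by
        exact_mod_cast mul_choose_pred hn0 (hk a)
      have e2 : (n : ℝ) * ((n - 1).choose (k b - 1) : ℕ) = k b * n.choose (k b) := by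
        exact_mod_cast mul_choose_pred hn0 (hk b)
      have h2 : (((n - 1).choose (k a - 1) : ℕ) : ℝ) * ((n - 1).choose (k b - 1) : ℕ) <
          #(F a) * #(F b) := by
        rw [← hp a, ← hp b]
        rw [div_lt_iff₀ (by positivity)] at h1
        have h3 := mul_lt_mul_of_pos_right h1 (mul_pos (hC a) (hC b))
        refine lt_of_mul_lt_mul_left (a := (n : ℝ) ^ 2) ?_ (by positivity)
        calc (n : ℝ) ^ 2 * (((n - 1).choose (k a - 1) : ℕ) * ((n - 1).choose (k b - 1) : ℕ))
            = (n * ((n - 1).choose (k a - 1) : ℕ)) * (n * ((n - 1).choose (k b - 1) : ℕ)) := by ring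
          _ = (k a * k b : ℝ) * (n.choose (k a) * n.choose (k b)) := by rw [e1, e2]; ring
          _ < _ := h3
          _ = _ := by ring
      exact_mod_cast h2
  · intro i hi S hS
    have hprod' : 1 / (n : ℝ) ^ 2 < ∏ i, p i := by
      refine lt_of_le_of_lt ?_ hprod
      gcongr
      exact_mod_cast Nat.mul_le_mul (hk _) (hk _)
    have hpow : 1 / (n : ℝ) ^ 2 < p i ^ ((i : ℕ) + 1) := by
      refine hprod'.trans_le ((hsub (Iic i)).trans ?_)
      calc ∏ j ∈ Iic i, p j ≤ ∏ _j ∈ Iic i, p i :=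
            prod_le_prod (fun j _ ↦ hp0 j) fun j hj ↦ hmono (mem_Iic.1 hj)
        _ = p i ^ ((i : ℕ) + 1) := by simp
    have hpi : 0 < p i := by
      refine (hp0 i).lt_of_ne fun h ↦ ?_
      rw [← h, zero_pow (by omega)] at hpow
      exact hpow.not_ge (by positivity)
    have hq := mul_one_sub_lt_of_lt_pow hpi hnR hpow
    push_cast at hq
    have hSK : #S ≤ K * i := by
      refine hS.trans ((sum_le_card_nsmul _ _ K fun j _ ↦ hkK j).trans ?_)
      simp [mul_comm]
    have hSsum : #S + k i ≤ ∑ j, k j := by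
      calc #S + k i ≤ ∑ j ∈ Iio i, k j + k i := by omega
        _ = ∑ j ∈ insert i (Iio i), k j := by rw [sum_insert (by simp), add_comm]
        _ ≤ ∑ j, k j := sum_le_sum_of_subset (subset_univ _)
    have hSsumR : (#S + k i : ℝ) ≤ ((∑ j, k j : ℕ) : ℝ) := by exact_mod_cast hSsum
    set x : ℝ := (8 * (K : ℝ) * Real.log n / n) ^ ((1 : ℝ) / (K : ℝ)) with hx
    have hx0 : 0 ≤ x := by positivity
    have hSx : (#S + k i : ℝ) ≤ n * (1 - x) := hSsumR.trans hsum
    have hSn : #S + k i ≤ n := by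
      have : (#S + k i : ℝ) ≤ n := by nlinarith
      exact_mod_cast this
    have hi0 : (0 : ℝ) < (i : ℝ) + 1 := by positivity
    have hkK' : ∀ j < k i, (j : ℝ) ≤ K := fun j hj ↦ by
      exact_mod_cast (hj.le.trans (hkK i))
    have hSKR : (#S : ℝ) ≤ K * i := by exact_mod_cast hSK
    -- Three ranges of `i`: order `n` (use `hsum`), up to order `log n` (union bound), and in
    -- between (half of the vertices remain free).
    rcases le_or_gt (n : ℝ) (4 * K * (i + 1)) with hc | hc
    · have hx1 : x ≤ 1 := by
        have : (0 : ℝ) ≤ n * (1 - x) := le_trans (by positivity) hSx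
        linarith [nonneg_of_mul_nonneg_right this hnR]
      refine exists_mem_disjoint_of_density (hF i) hx0 (hp i) hSn ?_ fun j hj ↦ ?_
      · have hxK : x ^ K = 8 * (K : ℝ) * Real.log n / n := by
          rw [hx, one_div, Real.rpow_inv_natCast_pow (by positivity) (by omega)]
        refine lt_of_lt_of_le ?_ (pow_le_pow_of_le_one hx0 hx1 (hkK i))
        rw [hxK, lt_div_iff₀ hnR]
        rcases le_or_gt (1 - p i) 0 with h0 | h0
        · have : 0 < Real.log n := by
            apply Real.log_pos
            exact_mod_cast (by omega : 1 < n)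
          exact lt_of_le_of_lt (mul_nonpos_of_nonpos_of_nonneg h0 hnR.le) (by positivity)
        · calc (1 - p i) * n ≤ (1 - p i) * (4 * K * (i + 1)) := by gcongr
            _ = 4 * K * ((i + 1) * (1 - p i)) := by ring
            _ < 4 * K * (2 * Real.log n) := by gcongr
            _ = _ := by ring
      · have hjk : (j : ℝ) ≤ k i := by exact_mod_cast hj.le
        have : 0 ≤ x * j := by positivity
        linarith
    · have hK4 : (4 * K : ℝ) ≤ n := by exact_mod_cast hn4
      rcases le_or_gt ((i : ℝ) + 1) (2 ^ (K + 1) * Real.log n) with ha | hb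
      · refine exists_mem_disjoint_of_union_bound (hF i) (hk i) (hp i) hSn ?_
        -- As `i ≥ 2`, the density exceeds `n ^ (-2/3)`, while by `hlog` the fraction of edges
        -- meeting `S` is at most that.
        have hp3 : 1 / (n : ℝ) ^ 2 < p i ^ 3 :=
          hpow.trans_le (pow_le_pow_of_le_one (hp0 i) (hp1 i) (by omega))
        set y : ℝ := (K : ℝ) ^ 2 * 2 ^ (K + 1) * Real.log n with hy
        have hSy : (#S * k i : ℝ) ≤ y := by
          have hki : (k i : ℝ) ≤ K := by exact_mod_cast hkK i
          calc (#S * k i : ℝ) ≤ K * i * K := by gcongr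
            _ = K ^ 2 * i := by ring
            _ ≤ K ^ 2 * (2 ^ (K + 1) * Real.log n) := by gcongr; linarith
            _ = y := by rw [hy]; ring
        refine lt_of_le_of_lt (div_le_div_of_nonneg_right hSy hnR.le) ?_
        refine lt_of_pow_lt_pow_left₀ 3 (hp0 i) (lt_of_le_of_lt ?_ hp3)
        calc (y / n) ^ 3 = y ^ 3 / n ^ 3 := div_pow _ _ _
          _ ≤ n / n ^ 3 := by gcongr
          _ = 1 / n ^ 2 := by field_simp
      · refine exists_mem_disjoint_of_density (r := 1 / 2) (hF i) (by norm_num) (hp i) hSn ?_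
          fun j hj ↦ ?_
        · refine lt_of_lt_of_le ?_
            (pow_le_pow_of_le_one (by norm_num) (by norm_num) (hkK i))
          have hD : (0 : ℝ) < 2 ^ K := by positivity
          rw [one_div, inv_pow, ← one_div, lt_div_iff₀ hD]
          -- Otherwise `1 - p i ≥ 2 ^ (-K)`, and `i + 1 > 2 ^ (K + 1) * log n` contradicts `hq`.
          by_contra! hge
          rw [pow_succ] at hb
          have h1 := mul_le_mul_of_nonneg_left hge hi0.le
          have h2 := mul_lt_mul_of_pos_right hq hD
          linarith
        · have := hkK' j hj
          nlinarith

/-! ### Reordering by density. -/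

theorem AdmitsRainbowMatching.of_comp_equiv {ι κ α : Type*} {F : ι → Finset (Finset α)}
    (σ : κ ≃ ι) (h : AdmitsRainbowMatching (F ∘ σ)) : AdmitsRainbowMatching F := by
  obtain ⟨e, he, hd⟩ := h
  refine ⟨e ∘ σ.symm, fun i ↦ ?_, fun i j hij ↦ hd _ _ (σ.symm.injective.ne hij)⟩
  simpa using he (σ.symm i)

/-- Splitting off the first two factors of a product over `Fin t`. -/
theorem prod_eq_mul_mul_prod_filter {M : Type*} [CommMonoid M] {t : ℕ} (ht : 2 ≤ t)
    (f : Fin t → M) : ∏ i, f i = f ⟨0, by omega⟩ * f ⟨1, by omega⟩ *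
      ∏ i ∈ univ.filter (fun i : Fin t ↦ 2 ≤ (i : ℕ)), f i := by
  have h : univ.filter (fun i : Fin t ↦ ¬ 2 ≤ (i : ℕ)) = {⟨0, by omega⟩, ⟨1, by omega⟩} := by
    ext ⟨i, hi⟩
    simp only [mem_filter, mem_univ, true_and, mem_insert, mem_singleton, Fin.mk.injEq]
    omega
  rw [← prod_filter_not_mul_prod_filter univ (fun i : Fin t ↦ 2 ≤ (i : ℕ)), h,
    prod_pair (by simp)]

theorem sq_mul_productBound {n t : ℕ} (ht : 2 ≤ t) (hn : 1 ≤ n) {k : Fin t → ℕ}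
    (hk : ∀ i, 1 ≤ k i) : n ^ 2 * productBound n ht k =
      k ⟨0, by omega⟩ * k ⟨1, by omega⟩ * ∏ i, n.choose (k i) := by
  rw [prod_eq_mul_mul_prod_filter ht, productBound]
  generalize ∏ i ∈ univ.filter (fun i : Fin t ↦ 2 ≤ (i : ℕ)), n.choose (k i) = P
  calc _ = (n * (n - 1).choose (k ⟨0, by omega⟩ - 1)) *
        (n * (n - 1).choose (k ⟨1, by omega⟩ - 1)) * P := by ring
    _ = _ := by rw [mul_choose_pred hn (hk _), mul_choose_pred hn (hk _)]; ring

/-- Sorting by density may bring any two families to the front; their threshold is no larger than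
that of the original first two. -/
theorem mul_le_mul_of_two_largest {t : ℕ} (ht : 2 ≤ t) {k : Fin t → ℕ}
    (h : ∀ i : Fin t, 2 ≤ (i : ℕ) → k i ≤ k ⟨0, by omega⟩ ∧ k i ≤ k ⟨1, by omega⟩)
    {a b : Fin t} (hab : a ≠ b) : k a * k b ≤ k ⟨0, by omega⟩ * k ⟨1, by omega⟩ := by
  obtain ⟨a, ha⟩ := a
  obtain ⟨b, hb⟩ := b
  have hab' : a ≠ b := fun h ↦ hab (Fin.ext h)
  match a, b with
  | 0, 0 | 1, 1 => exact absurd rfl hab'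
  | 0, 1 => exact le_rfl
  | 1, 0 => exact (mul_comm _ _).le
  | 0, b + 2 => exact Nat.mul_le_mul_left _ (h ⟨b + 2, hb⟩ (by simp)).2
  | 1, b + 2 => rw [mul_comm]; exact Nat.mul_le_mul_right _ (h ⟨b + 2, hb⟩ (by simp)).1
  | a + 2, 0 => rw [mul_comm]; exact Nat.mul_le_mul_left _ (h ⟨a + 2, ha⟩ (by simp)).2
  | a + 2, 1 => exact Nat.mul_le_mul_right _ (h ⟨a + 2, ha⟩ (by simp)).1
  | a + 2, b + 2 =>
    exact Nat.mul_le_mul (h ⟨a + 2, ha⟩ (by simp)).1 (h ⟨b + 2, hb⟩ (by simp)).2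

theorem admitsRainbowMatching_of_productBound_lt {n K t : ℕ} (ht : 2 ≤ t) (hK : 1 ≤ K)
    (hn : K ^ 4 < n) (hn4 : 4 * K ≤ n)
    (hlog : ((K : ℝ) ^ 2 * 2 ^ (K + 1) * Real.log n) ^ 3 ≤ n)
    {k : Fin t → ℕ} (hk : ∀ i, 1 ≤ k i) (hkK : ∀ i, k i ≤ K)
    (hk2 : ∀ i : Fin t, 2 ≤ (i : ℕ) → k i ≤ k ⟨0, by omega⟩ ∧ k i ≤ k ⟨1, by omega⟩)
    (hsum : ((∑ i, k i : ℕ) : ℝ) ≤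
      (n : ℝ) * (1 - (8 * (K : ℝ) * Real.log n / n) ^ ((1 : ℝ) / (K : ℝ))))
    {F : Fin t → Finset (Finset (Fin n))} (hF : IsUniformFamily n k F)
    (h : productBound n ht k < ∏ i, #(F i)) : AdmitsRainbowMatching F := by
  have hnR : (0 : ℝ) < n := by exact_mod_cast (by omega : 0 < n)
  have hC : ∀ i, (0 : ℝ) < n.choose (k i) := fun i ↦ by
    exact_mod_cast Nat.choose_pos (by have := hkK i; omega)
  let p : Fin t → ℝ := fun i ↦ #(F i) / n.choose (k i)
  let σ := Tuple.sort p
  refine AdmitsRainbowMatching.of_comp_equiv σ ?_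
  refine admitsRainbowMatching_of_monotone ht hK hn hn4 hlog (k := k ∘ σ) (p := p ∘ σ)
    (fun i ↦ hk _) (fun i ↦ hkK _) ?_ (fun i ↦ hF _) (fun i ↦ div_mul_cancel₀ _ (hC _).ne')
    (Tuple.monotone_sort p) ?_
  · rwa [show ∑ i, (k ∘ σ) i = ∑ i, k i from Equiv.sum_comp σ k]
  · rw [show ∏ i, (p ∘ σ) i = ∏ i, p i from Equiv.prod_comp σ p]
    have h1 : ((k (σ ⟨0, by omega⟩) * k (σ ⟨1, by omega⟩) : ℕ) : ℝ) ≤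
        (k ⟨0, by omega⟩ * k ⟨1, by omega⟩ : ℕ) := by
      exact_mod_cast mul_le_mul_of_two_largest ht hk2 (σ.injective.ne (by simp))
    have h2 : ((n ^ 2 * productBound n ht k : ℕ) : ℝ) < (n ^ 2 * ∏ i, #(F i) : ℕ) := by
      exact_mod_cast Nat.mul_lt_mul_of_pos_left h (pow_pos (by omega : 0 < n) 2)
    rw [sq_mul_productBound ht (by omega) hk] at h2
    have hP : (0 : ℝ) < ∏ i, (n.choose (k i) : ℝ) := prod_pos fun i _ ↦ hC i
    simp only [p, prod_div_distrib, Function.comp_apply]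
    push_cast at h1 h2
    rw [div_lt_div_iff₀ (by positivity) hP]
    calc _ ≤ _ := mul_le_mul_of_nonneg_right h1 hP.le
      _ < _ := h2
      _ = _ := mul_comm _ _

/-! ### Tightness and conclusion. -/

/-- The first two families are stars with a common centre, the others are complete. -/
theorem exists_uniform_not_admitsRainbowMatching {n t : ℕ} (ht : 2 ≤ t) (hn : 1 ≤ n)
    {k : Fin t → ℕ} (hk : ∀ i, 1 ≤ k i) : ∃ R : Fin t → Finset (Finset (Fin n)),
      IsUniformFamily n k R ∧ ¬ AdmitsRainbowMatching R ∧
        ∏ i, #(R i) = productBound n ht k := by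
  let v : Fin n := ⟨0, hn⟩
  refine ⟨fun i ↦ {e ∈ powersetCard (k i) univ | 2 ≤ (i : ℕ) ∨ v ∈ e}, fun i ↦ filter_subset _ _,
    ?_, ?_⟩
  · rintro ⟨e, he, hd⟩
    have h0 := (mem_filter.1 (he ⟨0, by omega⟩)).2.resolve_left (by simp)
    have h1 := (mem_filter.1 (he ⟨1, by omega⟩)).2.resolve_left (by simp)
    exact disjoint_left.1 (hd _ _ (by simp)) h0 h1
  · rw [prod_eq_mul_mul_prod_filter ht, productBound]
    have hs := fun i ↦ card_star (hk i) v
    rw [Fintype.card_fin] at hs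
    congr 1
    · simp [hs]
    · refine prod_congr rfl fun i hi ↦ ?_
      simp [(mem_filter.1 hi).2]

theorem eventually_mul_log_pow_le (c : ℝ) (m : ℕ) :
    ∀ᶠ n : ℕ in atTop, (c * Real.log n) ^ m ≤ n := by
  have h := (Real.isLittleO_pow_log_id_atTop (n := m)).const_mul_left (c ^ m)
  filter_upwards [tendsto_natCast_atTop_atTop.eventually (h.bound one_pos)] with n hn
  rw [mul_pow]
  simpa using (le_abs_self _).trans hn

theorem theorem1p3 (kmax : ℕ) :
    ∃ n₀ : ℕ, ∀ n : ℕ, n₀ ≤ n →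
      ∀ (t : ℕ) (ht : 2 ≤ t) (k : Fin t → ℕ),
        (∀ i, 1 ≤ k i) →
        IsGreatest (Set.range k) kmax →
        (∀ i : Fin t, 2 ≤ (i : ℕ) → k i ≤ k ⟨0, by omega⟩ ∧ k i ≤ k ⟨1, by omega⟩) →
        ((∑ i, k i : ℕ) : ℝ) ≤
          (n : ℝ) * (1 - (8 * (kmax : ℝ) * Real.log n / n) ^ ((1 : ℝ) / (kmax : ℝ))) →
        (∀ F : Fin t → Finset (Finset (Fin n)), IsUniformFamily n k F →
            productBound n ht k < ∏ i, (F i).card → AdmitsRainbowMatching F) ∧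
          IsGreatest
            {m : ℕ | ∃ R : Fin t → Finset (Finset (Fin n)),
              IsUniformFamily n k R ∧ ¬ AdmitsRainbowMatching R ∧ ∏ i, (R i).card = m}
            (productBound n ht k) := by
  obtain ⟨n₁, hn₁⟩ := eventually_atTop.1
    (eventually_mul_log_pow_le ((kmax : ℝ) ^ 2 * 2 ^ (kmax + 1)) 3)
  refine ⟨n₁ + kmax ^ 4 + 4 * kmax + 1, fun n hn t ht k hk hmax hk2 hsum ↦ ?_⟩
  have hkK : ∀ i, k i ≤ kmax := fun i ↦ hmax.2 ⟨i, rfl⟩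
  have hK : 1 ≤ kmax := (hk ⟨0, by omega⟩).trans (hkK _)
  have main : ∀ F : Fin t → Finset (Finset (Fin n)), IsUniformFamily n k F →
      productBound n ht k < ∏ i, (F i).card → AdmitsRainbowMatching F := fun F hF h ↦
    admitsRainbowMatching_of_productBound_lt ht hK (by omega) (by omega) (hn₁ n (by omega)) hk hkK
      hk2 hsum hF h
  refine ⟨main, exists_uniform_not_admitsRainbowMatching ht (by omega) hk, ?_⟩
  rintro m ⟨R, hR, hR', rfl⟩
  exact not_lt.1 fun h ↦ hR' (main R hR h)
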